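/- Let $K$ be an oriented virtual link diagram (for example, a virtual knot diagram) with $n$ classical crossings, all of them positive. Consider the Khovanov--Lee complex of $K$ over $\mathbb{Q}$: it is spanned by the enhanced states of $K$, its differential is built from the Frobenius algebra $\mathbb{Q}[X]/(X^2-1)$ with $\Delta(1)=1\otimes X+X\otimes 1$ and $\Delta(X)=X\otimes X+1\otimes 1$ and from the zero map for single-cycle smoothings, with the bar operation $\overline{X}=-X$, $\overline{1}=1$ applied at cut loci of the canonical source-sink orientation and with the signs that compare the local and global orders of the cycles. It is filtered by the quantum grading $q(s)=i(s)+\lambda(s)+n_+-2n_-$, where $i(s)$ is the number of $B$-smoothings of the enhanced state $s$ and $\lambda(s)$ is the number of its cycles labeled $1$ minus the number of its cycles labeled $X$. Let $s_{\min}(K)$ be the lowest filtration level of the homology $\widehat{Kh}(K)$ with the induced filtration. Let $s_0$ be a canonical generator given by the orientation of $K$ or by its reverse, that is, the state of all oriented smoothings with its cycles decorated by $\mathbf{r}=\frac{1+X}{2}$ and $\mathbf{g}=\frac{1-X}{2}$ according to whether that orientation agrees or disagrees with the source-sink orientation at the marked point of the cycle, and let $r$ be the number of cycles of this state. Let $q(s_0)$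 be the quantum grading of this state with all its cycles decorated by $X$. Then $s_0$ is a cocycle, the filtration degree of the chain $s_0$ and that of its homology class are both $q(s_0)$, and $$ s_{\min}(K) = q(s_0) = -r+n . $$ -/

import Mathlib

namespace VirtualKhovanov

/-! ### Virtual link diagrams and their states -/

/-- An oriented virtual link diagram, up to moves that involve only virtual crossings, given by
its signed oriented Gauss code. There are `n` classical crossings; every classical crossing is
passed twice, and `(c, true)` / `(c, false)` is the passage through `c` along its over / under
strand. `next v` is the passage reached from the passage `v` by following the orientation of the
link along one semi-arc. `positive c` says that the crossing `c` is positive. `free` is the number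
of link components that do not pass through any classical crossing. -/
structure VirtualLinkDiagram where
  n : ℕ
  next : Equiv.Perm (Fin n × Bool)
  positive : Fin n → Bool
  free : ℕ

variable (K : VirtualLinkDiagram)

/-- The half-edges at the classical crossings: `(v, false)` is the half-edge on which the link
enters the crossing in the passage `v`, and `(v, true)` the half-edge on which it leaves. -/
abbrev Dart := (Fin K.n × Bool) × Bool

/-- The other half of the semi-arc to which a half-edge belongs. -/
def opp : Dart K → Dart K
  | (v, true) => (K.next v, false)
  | (v, false) => (K.next.symm v, true)

/-- A state: a choice of smoothing, `false` for `A` and `true` for `B`, at every crossing. -/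
abbrev State := Fin K.n → Bool

/-- The half-edge to which a half-edge is joined, at its crossing, by the smoothing in `s`.
At a positive crossing the `A`-smoothing is the oriented one, at a negative crossing the
`B`-smoothing is. The oriented smoothing joins an incoming half-edge to the outgoing half-edge of
the other strand; the other smoothing joins the two incoming and the two outgoing half-edges. -/
def smooth (s : State K) : Dart K → Dart K
  | ((c, o), e) => if s c = !(K.positive c) then ((c, !o), !e) else ((c, !o), e)

/-- Two half-edges lie on the same cycle of the state `s`. -/
def cycleSetoid (s : State K) : Setoid (Dart K) :=
  Relation.EqvGen.setoid fun x y => y = opp K x ∨ y = smooth K s x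

/-- The cycles of the state `s` that pass through smoothings. -/
abbrev DCycle (s : State K) := Quotient (cycleSetoid K s)

/-- All cycles of the state `s`. -/
abbrev StateCycle (s : State K) := DCycle K s ⊕ Fin K.free

/-- The cycle of the state `s` through a half-edge. -/
def cyc (s : State K) (x : Dart K) : DCycle K s := Quotient.mk _ x

noncomputable instance (s : State K) : Fintype (StateCycle K s) := Fintype.ofFinite _

/-! ### Source-sink orientations and cut loci -/

/-- Draw a crossing with both strands pointing up. `leftward c` is the strand that runs from the
lower right to the upper left: the under strand of a positive, the over strand of a negative
crossing. -/
def leftward (c : Fin K.n) : Bool := !(K.positive c)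

/-- The canonical source-sink orientation at a crossing: both half-edges of the strand from the
lower left to the upper right point into the crossing, and both half-edges of the other strand
point out of it. `agrees x` says that on the half-edge `x` this local orientation agrees with the
orientation of the link. -/
def agrees : Dart K → Bool
  | ((c, o), e) => (o == leftward K c) == e

/-- There is a cut locus on the semi-arc of `x`: the source-sink orientations at its two ends
disagree. -/
def hasCut (x : Dart K) : Bool := xor (agrees K x) (agrees K (opp K x))

/-- `Transport K s x y p`: there is a path along a cycle of `s` from `x` to `y` which crosses an
even (`p = false`) or an odd (`p = true`) number of cut loci. -/
inductive Transport (s : State K) (x : Dart K) : Dart K → Bool → Prop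
  | refl : Transport s x x false
  | smooth {y : Dart K} {p : Bool} : Transport s x y p → Transport s x (smooth K s y) p
  | edge {y : Dart K} {p : Bool} : Transport s x y p → Transport s x (opp K y) (xor p (hasCut K y))

/-! ### Global orientation and global order of the cycles of a state -/

/-- An auxiliary numbering of the half-edges. -/
def code : Dart K → ℕ
  | ((c, o), e) => 4 * (c : ℕ) + 2 * o.toNat + e.toNat

theorem exists_mark (s : State K) (γ : DCycle K s) :
    ∃ x, cyc K s x = γ ∧ ∀ y, cyc K s y = γ → code K x ≤ code K y := by
  classical
  obtain ⟨x₀, hx₀⟩ := Quotient.exists_rep γ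
  obtain ⟨x, hx, hmin⟩ := Finset.exists_min_image
    (Finset.univ.filter fun x : Dart K => cyc K s x = γ) (code K)
    ⟨x₀, Finset.mem_filter.mpr ⟨Finset.mem_univ _, hx₀⟩⟩
  refine ⟨x, (Finset.mem_filter.mp hx).2, fun y hy => hmin y ?_⟩
  exact Finset.mem_filter.mpr ⟨Finset.mem_univ _, hy⟩

/-- The marked point of a cycle, which fixes its global orientation: its first half-edge. -/
noncomputable def mark (s : State K) (γ : DCycle K s) : Dart K :=
  Classical.choose (exists_mark K s γ)

open Classical in
/-- The position (from `0`) of a cycle in the global order of the cycles of `s`, in which cycles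
are listed by their marked points. Cycles without smoothings come last, in a fixed order; they
never take part in a differential. -/
noncomputable def position (s : State K) (γ : DCycle K s) : ℕ :=
  Nat.card {γ' : DCycle K s // code K (mark K s γ') < code K (mark K s γ)}

/-- A half-edge on the arc with local label `1` at the crossing `c`, in either smoothing: the
upper left half-edge. So `1` is the left arc of the oriented smoothing, and the upper arc of the
other one. -/
def first (c : Fin K.n) : Dart K := ((c, leftward K c), true)

/-- A half-edge on the arc with local label `2` at the crossing `c`, in either smoothing: the
lower right half-edge. -/
def second (c : Fin K.n) : Dart K := ((c, leftward K c), false)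

open Classical in
/-- The sign of the permutation between the global order of the cycles of `s` and the local order
at `c`, in which the cycle(s) with local labels `1` and `2` come first, in this order, and all
other cycles keep their relative order. -/
noncomputable def orderSign (s : State K) (c : Fin K.n) : ℚ :=
  let a := position K s (cyc K s (first K c))
  let b := position K s (cyc K s (second K c))
  if cyc K s (first K c) = cyc K s (second K c) then (-1) ^ a
  else if a < b then (-1) ^ (a + b + 1) else (-1) ^ (a + b)

/-! ### The Frobenius algebra `ℚ[X] / (X ^ 2 - 1)` -/

/-- The basis `1`, `X` of the algebra. -/
inductive Label
  | one
  | X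
  deriving DecidableEq

instance : Fintype Label where
  elems := {Label.one, Label.X}
  complete l := by cases l <;> simp

/-- `mulCoeff a b c` is the coefficient of `c` in `m (a ⊗ b)`, where `X * X = 1`. -/
def mulCoeff : Label → Label → Label → ℚ
  | .one, .one, .one => 1
  | .one, .X, .X => 1
  | .X, .one, .X => 1
  | .X, .X, .one => 1
  | _, _, _ => 0

/-- `comulCoeff a b c` is the coefficient of `b ⊗ c` in `Δ a`, where `Δ 1 = 1 ⊗ X + X ⊗ 1` and
`Δ X = X ⊗ X + 1 ⊗ 1`. -/
def comulCoeff : Label → Label → Label → ℚ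
  | .one, .one, .X => 1
  | .one, .X, .one => 1
  | .X, .X, .X => 1
  | .X, .one, .one => 1
  | _, _, _ => 0

open Classical in
/-- The factor by which a label on the cycle through `x` changes on transport between `x` and the
marked point of the cycle: every cut locus on the way applies the bar operation `1 ↦ 1`,
`X ↦ -X`. -/
noncomputable def barSign (s : State K) (x : Dart K) (l : Label) : ℚ :=
  if l = Label.X ∧ Transport K s x (mark K s (cyc K s x)) true then -1 else 1

/-! ### The Khovanov-Lee complex -/

/-- Enhanced states: a state together with a label on each of its cycles. -/
abbrev Enhanced := Σ s : State K, (StateCycle K s → Label)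

/-- Chains: rational linear combinations of enhanced states. -/
abbrev Chain := Enhanced K →₀ ℚ

/-- The state obtained from `s` by putting the `B`-smoothing at `c`. -/
def resmooth (s : State K) (c : Fin K.n) : State K := Function.update s c true

/-- The labelings `l` of `s` and `l'` of the resmoothing at `c` agree on all cycles that do not
pass the site `c`. -/
def AgreeAway (s : State K) (c : Fin K.n) (l : StateCycle K s → Label)
    (l' : StateCycle K (resmooth K s c) → Label) : Prop :=
  (∀ i : Fin K.free, l' (Sum.inr i) = l (Sum.inr i)) ∧
  ∀ x : Dart K, cyc K s x ≠ cyc K s (first K c) → cyc K s x ≠ cyc K s (second K c) →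
    l' (Sum.inl (cyc K (resmooth K s c) x)) = l (Sum.inl (cyc K s x))

open Classical in
/-- The matrix coefficient of the partial differential at the site `c` from `(s, l)` to
`(resmooth K s c, l')`. It is `m` if two cycles merge, `Δ` if a cycle splits, and `η = 0` if a
single cycle is turned into a single cycle, pre- and post-composed with the bar operations that
compare local and global orientation and with the signs that compare local and global order. -/
noncomputable def coeff (s : State K) (c : Fin K.n) (l : StateCycle K s → Label)
    (l' : StateCycle K (resmooth K s c) → Label) : ℚ :=
  let s' := resmooth K s c
  let x := first K c
  let y := second K c
  let a := l (Sum.inl (cyc K s x))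
  let b := l (Sum.inl (cyc K s y))
  let a' := l' (Sum.inl (cyc K s' x))
  let b' := l' (Sum.inl (cyc K s' y))
  if AgreeAway K s c l l' then
    orderSign K s c * orderSign K s' c *
      (if cyc K s x ≠ cyc K s y ∧ cyc K s' x = cyc K s' y then
        barSign K s x a * barSign K s y b * mulCoeff a b a' * barSign K s' x a'
      else if cyc K s x = cyc K s y ∧ cyc K s' x ≠ cyc K s' y then
        barSign K s x a * comulCoeff a a' b' * barSign K s' x a' * barSign K s' y b'
      else 0)
  else 0

open Classical in
/-- The differential of an enhanced state: the sum of the partial differentials at all sites with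
`A`-smoothing. -/
noncomputable def boundary (e : Enhanced K) : Chain K :=
  ∑ c : Fin K.n, if e.1 c = false then
    ∑ l' : (StateCycle K (resmooth K e.1 c) → Label),
      Finsupp.single (⟨resmooth K e.1 c, l'⟩ : Enhanced K) (coeff K e.1 c e.2 l')
    else 0

/-- The differential of the Khovanov-Lee complex. -/
noncomputable def d : Chain K →ₗ[ℚ] Chain K := Finsupp.linearCombination ℚ (boundary K)

/-- Khovanov-Lee homology, summed over all homological degrees. -/
abbrev Homology :=
  LinearMap.ker (d K) ⧸ (LinearMap.range (d K)).submoduleOf (LinearMap.ker (d K))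

/-- The homology class of a cycle of the complex. -/
noncomputable def homologyClass (z : LinearMap.ker (d K)) : Homology K := Submodule.Quotient.mk z

/-! ### The quantum filtration and the lowest filtration level -/

/-- The number of `B`-smoothings. -/
def numB (s : State K) : ℤ := ((Finset.univ.filter fun c => s c = true).card : ℤ)

/-- The number of positive crossings. -/
def nPos : ℤ := ((Finset.univ.filter fun c => K.positive c = true).card : ℤ)

/-- The number of negative crossings. -/
def nNeg : ℤ := ((Finset.univ.filter fun c => K.positive c = false).card : ℤ)

/-- The number of cycles labeled `1` minus the number of cycles labeled `X`. -/
noncomputable def lam (e : Enhanced K) : ℤ :=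
  ∑ γ : StateCycle K e.1, if e.2 γ = Label.one then 1 else -1

/-- The quantum grading `q = j + n₊ - 2 n₋` with `j = i + λ`. -/
noncomputable def q (e : Enhanced K) : ℤ := numB K e.1 + lam K e + nPos K - 2 * nNeg K

/-- The quantum filtration of the chain complex. -/
noncomputable def filtration (j : ℤ) : Submodule ℚ (Chain K) :=
  Finsupp.supported ℚ ℚ {e | j ≤ q K e}

/-- The filtration degree of a chain is `j`. -/
def ChainLevel (x : Chain K) (j : ℤ) : Prop :=
  x ∈ filtration K j ∧ x ∉ filtration K (j + 1)

/-- The induced filtration of the homology: the classes that have a representative in the given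
step of the filtration of the complex. -/
noncomputable def homologyFiltration (j : ℤ) : Submodule ℚ (Homology K) :=
  ((filtration K j).submoduleOf (LinearMap.ker (d K))).map
    ((LinearMap.range (d K)).submoduleOf (LinearMap.ker (d K))).mkQ

/-- The filtration degree of a homology class is `j`. (Such a class is not zero.) -/
def HomologyLevel (y : Homology K) (j : ℤ) : Prop :=
  y ∈ homologyFiltration K j ∧ y ∉ homologyFiltration K (j + 1)

/-- The filtration levels of the homology. -/
def filtrationLevels : Set ℤ := {j | ∃ y : Homology K, HomologyLevel K y j}

/-- The lowest filtration level of the homology. -/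
noncomputable def sMin : ℤ := sInf (filtrationLevels K)

/-! ### Canonical generators -/

/-- The state of all oriented smoothings. -/
def orientedState : State K := fun c => !(K.positive c)

/-- The coefficient of a label in red `= (1 + X) / 2` (for `true`) or green `= (1 - X) / 2`
(for `false`). -/
def colorCoeff (red : Bool) : Label → ℚ
  | .one => 1 / 2
  | .X => if red then 1 / 2 else -1 / 2

/-- The color at the marked point of a cycle of the oriented state: red if there the orientation
of the link (`o = true`) or its reverse (`o = false`) agrees with the source-sink orientation. The
local orientation of a component without classical crossings is that of the link. -/
noncomputable def color (o : Bool) : StateCycle K (orientedState K) → Bool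
  | .inl γ => agrees K (mark K (orientedState K) γ) == o
  | .inr _ => o

open Classical in
/-- The canonical generator given by the orientation of the link (`o = true`) or by its reverse
(`o = false`): the oriented state with its cycles decorated by red and green. -/
noncomputable def canonicalGenerator (o : Bool) : Chain K :=
  ∑ l : (StateCycle K (orientedState K) → Label),
    Finsupp.single (⟨orientedState K, l⟩ : Enhanced K)
      (∏ γ : StateCycle K (orientedState K), colorCoeff (color K o γ) (l γ))

/-- The oriented state with all its cycles decorated by `X`. -/
def orientedX : Enhanced K := ⟨orientedState K, fun _ => Label.X⟩

end VirtualKhovanov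

open VirtualKhovanov

namespace VirtualKhovanov

variable {K : VirtualLinkDiagram}

/-! ### Cycles of states -/

/-! When all crossings are positive, the oriented state is the all-`A` state, so it lies in
homological degree zero and no differential has a component there. Passing from `A` to `B` at a
crossing raises `numB` by one and creates at most one new cycle (`card_stateCycle_resmooth_le`), so
`q` is smallest at `orientedX`, and the filtration step of that level is the whole complex. A
canonical generator has nonzero coefficient at `orientedX`, and adding a boundary cannot change this
coefficient; hence its class lies in no higher step.

It remains that the generators are cocycles. A resmoothing of the oriented state never splits a
cycle (`cyc_resmooth_orientedState_first_eq_second`). If one cycle stays one cycle, the map is zero.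
If two cycles merge, their colors, transported to the crossing, are one red and one green, and `r *
g = (1 - X ^ 2) / 4 = 0`. -/

theorem opp_opp (x : Dart K) : opp K (opp K x) = x := by
  rcases x with ⟨v, _ | _⟩ <;> simp [opp]

theorem smooth_smooth (s : State K) (x : Dart K) : smooth K s (smooth K s x) = x := by
  rcases x with ⟨⟨c, o⟩, e⟩
  by_cases h : s c = !(K.positive c) <;> simp [smooth, h]

theorem cyc_opp (s : State K) (x : Dart K) : cyc K s (opp K x) = cyc K s x :=
  (Quotient.sound (s := cycleSetoid K s) (Relation.EqvGen.rel _ _ (Or.inl rfl))).symm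

theorem cyc_smooth (s : State K) (x : Dart K) : cyc K s (smooth K s x) = cyc K s x :=
  (Quotient.sound (s := cycleSetoid K s) (Relation.EqvGen.rel _ _ (Or.inr rfl))).symm

theorem eq_of_cyc_eq {α : Type*} (s : State K) (f : Dart K → α)
    (hopp : ∀ x, f (opp K x) = f x) (hsmooth : ∀ x, f (smooth K s x) = f x) {x y : Dart K}
    (h : cyc K s x = cyc K s y) : f x = f y := by
  have h' : Relation.EqvGen (fun x y => y = opp K x ∨ y = smooth K s x) x y := Quotient.exact h
  induction h' with
  | rel x y hxy =>
    rcases hxy with rfl | rfl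
    · exact (hopp x).symm
    · exact (hsmooth x).symm
  | refl x => rfl
  | symm x y _ ih => exact (ih h.symm).symm
  | trans x y z h₁ h₂ ih₁ ih₂ => exact (ih₁ (Quotient.sound h₁)).trans (ih₂ (Quotient.sound h₂))

theorem smooth_resmooth_of_ne (s : State K) {c : Fin K.n} {x : Dart K} (hx : x.1.1 ≠ c) :
    smooth K (resmooth K s c) x = smooth K s x := by
  rcases x with ⟨⟨c', o⟩, e⟩
  have hc : resmooth K s c c' = s c' := Function.update_of_ne hx _ _
  simp only [smooth, hc]

theorem cyc_eq_first_or_second (s : State K) (c : Fin K.n) (o e : Bool) :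
    cyc K s ((c, o), e) = cyc K s (first K c) ∨ cyc K s ((c, o), e) = cyc K s (second K c) := by
  by_cases ho : o = leftward K c
  · subst ho
    cases e
    · exact Or.inr rfl
    · exact Or.inl rfl
  · have ho' : (!o) = leftward K c := by
      revert ho; cases o <;> cases leftward K c <;> simp
    rw [← cyc_smooth]
    simp only [smooth, ho']
    split_ifs <;> cases e
    · exact Or.inl rfl
    · exact Or.inr rfl
    · exact Or.inr rfl
    · exact Or.inl rfl

open Classical in
-- Once the cycles through `first K c` and `second K c` in the new state are identified, all four
-- half-edges at `c` become equivalent, so the quotient map `g` is constant on the cycles of `s`.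
-- Only the class of `second K c` can be missed by `g`; `none` supplies it and accounts for the `+
-- 1`.
theorem card_stateCycle_resmooth_le (s : State K) (c : Fin K.n) :
    Nat.card (StateCycle K (resmooth K s c)) ≤ Nat.card (StateCycle K s) + 1 := by
  set s' := resmooth K s c with hs'
  let g : Dart K → DCycle K s' := fun x =>
    if cyc K s' x = cyc K s' (second K c) then cyc K s' (first K c) else cyc K s' x
  have hg : ∀ o e, g ((c, o), e) = cyc K s' (first K c) := by
    intro o e
    rcases cyc_eq_first_or_second s' c o e with h | h <;> simp [g, h]
  have hgopp : ∀ x, g (opp K x) = g x := fun x => by simp only [g, cyc_opp]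
  have hgsmooth : ∀ x, g (smooth K s x) = g x := by
    intro x
    by_cases hx : x.1.1 = c
    · rcases x with ⟨⟨c', o⟩, e⟩
      obtain rfl : c' = c := hx
      simp only [smooth]
      split_ifs <;> rw [hg, hg]
    · rw [← smooth_resmooth_of_ne s hx]
      simp only [g, ← hs', cyc_smooth]
  let G : Option (DCycle K s) → DCycle K s' := fun γ =>
    γ.elim (cyc K s' (second K c))
      (Quotient.lift g fun x y h => eq_of_cyc_eq s g hgopp hgsmooth (Quotient.sound h))
  have hG : Function.Surjective G := by
    intro γ
    obtain ⟨x, rfl⟩ := Quotient.exists_rep γ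
    by_cases hx : cyc K s' x = cyc K s' (second K c)
    · exact ⟨none, hx.symm⟩
    · exact ⟨some (cyc K s x), if_neg hx⟩
  have h := Nat.card_le_card_of_surjective G hG
  rw [Finite.card_option] at h
  rw [Nat.card_sum, Nat.card_sum]
  omega

theorem card_stateCycle_le (s : State K) :
    Nat.card (StateCycle K s) ≤
      Nat.card (StateCycle K fun _ => false) + (Finset.univ.filter fun c => s c = true).card := by
  suffices h : ∀ F : Finset (Fin K.n), Nat.card (StateCycle K fun c => decide (c ∈ F)) ≤
      Nat.card (StateCycle K fun _ => false) + F.card by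
    have hs : s = fun c => decide (c ∈ Finset.univ.filter fun c => s c = true) := by
      funext c; simp
    refine le_trans (le_of_eq ?_) (h (Finset.univ.filter fun c => s c = true))
    rw [← hs]
  intro F
  induction F using Finset.induction_on with
  | empty => simp
  | insert c F hc ih =>
    have hF : (fun c' => decide (c' ∈ insert c F)) =
        resmooth K (fun c' => decide (c' ∈ F)) c := by
      funext c'
      by_cases h : c' = c
      · subst h; simp [resmooth]
      · simp [resmooth, h]
    rw [hF, Finset.card_insert_of_notMem hc]
    exact (card_stateCycle_resmooth_le _ c).trans (by omega)

/-! ### Transport along the cycles of the oriented state -/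

theorem exists_transport (s : State K) {x y : Dart K} (h : cyc K s x = cyc K s y) :
    ∃ p, Transport K s x y p := by
  have hopp : ∀ y, (∃ p, Transport K s x y p) → ∃ p, Transport K s x (opp K y) p :=
    fun y ⟨_, hp⟩ => ⟨_, hp.edge⟩
  have hsmooth : ∀ y, (∃ p, Transport K s x y p) → ∃ p, Transport K s x (smooth K s y) p :=
    fun y ⟨_, hp⟩ => ⟨_, hp.smooth⟩
  have key : (∃ p, Transport K s x x p) = ∃ p, Transport K s x y p :=
    eq_of_cyc_eq s (fun y => ∃ p, Transport K s x y p)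
      (fun y => propext ⟨fun h => by simpa only [opp_opp] using hopp _ h, hopp y⟩)
      (fun y => propext ⟨fun h => by simpa only [smooth_smooth] using hsmooth _ h, hsmooth y⟩) h
  exact key ▸ ⟨false, Transport.refl⟩

theorem agrees_smooth_orientedState (x : Dart K) :
    agrees K (smooth K (orientedState K) x) = agrees K x := by
  rcases x with ⟨⟨c, o⟩, e⟩
  simp only [smooth, orientedState, agrees, if_true]
  cases o <;> cases e <;> cases leftward K c <;> rfl

/-- Oriented smoothings flip both strand and direction, hence preserve `agrees`, while a cut locus
is exactly where `agrees` changes. So in the oriented state the parity of cut loci along a path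
depends only on its endpoints. -/
theorem agrees_of_transport {x y : Dart K} {p : Bool}
    (h : Transport K (orientedState K) x y p) : agrees K y = xor (agrees K x) p := by
  induction h with
  | refl => simp
  | smooth _ ih => rw [agrees_smooth_orientedState, ih]
  | @edge y p _ ih =>
    rw [hasCut, ih]
    cases agrees K x <;> cases p <;> cases agrees K (opp K y) <;> rfl

theorem cyc_mark (s : State K) (γ : DCycle K s) : cyc K s (mark K s γ) = γ :=
  (Classical.choose_spec (exists_mark K s γ)).1

theorem transport_mark_true_iff (x : Dart K) :
    Transport K (orientedState K) x (mark K (orientedState K) (cyc K (orientedState K) x)) true ↔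
      agrees K (mark K (orientedState K) (cyc K (orientedState K) x)) ≠ agrees K x := by
  constructor
  · intro h
    rw [agrees_of_transport h]
    simp
  · intro h
    obtain ⟨p, hp⟩ := exists_transport (orientedState K) (cyc_mark _ (cyc K _ x)).symm
    cases p
    · exact absurd (by simpa using agrees_of_transport hp) h
    · exact hp

/-- The resmoothing of an oriented state at a crossing never splits a cycle. -/
theorem cyc_resmooth_orientedState_first_eq_second (hK : ∀ c : Fin K.n, K.positive c = true)
    (c : Fin K.n) :
    cyc K (resmooth K (orientedState K) c) (first K c) =
      cyc K (resmooth K (orientedState K) c) (second K c) := by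
  set s' := resmooth K (orientedState K) c with hs'
  by_contra hne
  have hs'c : s' c = true := by simp [hs', resmooth]
  -- The unoriented smoothing at `c` joins the two incoming half-edges, one of which is `second K
  -- c`.
  have hin : ∀ o, cyc K s' ((c, o), false) = cyc K s' (second K c) := by
    intro o
    by_cases ho : o = leftward K c
    · rw [ho]; rfl
    · have ho' : (!o) = leftward K c := by
        revert ho; cases o <;> cases leftward K c <;> simp
      rw [← cyc_smooth]
      simp only [smooth, hs'c, hK, ho']
      rfl
  let flip : Equiv.Perm (Fin K.n × Bool) := (Equiv.refl _).prodCongr Equiv.boolNot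
  -- The passages whose outgoing half-edge lies on the cycle of `first K c`. The semi-arc leaving
  -- such a passage cannot enter `c`, where incoming half-edges lie on the other cycle; elsewhere
  -- the oriented smoothing continues it to a passage in `U` again.
  let U : Set (Fin K.n × Bool) := {v | cyc K s' (v, true) = cyc K s' (first K c)}
  have hentry : ∀ v ∈ U, cyc K s' (K.next v, false) = cyc K s' (first K c) := fun v hv =>
    (cyc_opp s' (v, true)).trans hv
  have hleave : ∀ v ∈ U, (K.next v).1 ≠ c := by
    intro v hv hc
    apply hne
    rw [← hentry v hv, ← hin (K.next v).2, ← hc]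
  have hmaps : Set.MapsTo (K.next.trans flip : Equiv.Perm _) U U := by
    intro v hv
    have h : smooth K s' (K.next v, false) = (flip (K.next v), true) := by
      rw [hs', smooth_resmooth_of_ne _ (hleave v hv)]
      simp only [smooth, orientedState, if_true, Bool.not_false]
      rfl
    change cyc K s' (flip (K.next v), true) = _
    rw [← h, cyc_smooth, hentry v hv]
  -- On a finite set an invariant `U` is also invariant under the inverse permutation. The
  -- predecessor of `(c, leftward K c)` is thus in `U`, yet its semi-arc enters `c`.
  have hmem := Equiv.Perm.perm_symm_mapsTo_of_mapsTo _ hmaps (x := (c, leftward K c)) rfl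
  have hfl : flip (K.next ((K.next.trans flip : Equiv.Perm _).symm (c, leftward K c))) =
      (c, leftward K c) :=
    Equiv.apply_symm_apply (K.next.trans flip : Equiv.Perm _) _
  exact hleave _ hmem (congrArg Prod.fst hfl)

/-! ### The canonical generators are cocycles -/

/-- The exchange of the labels `1` and `X`. -/
def Label.swap : Label → Label
  | .one => .X
  | .X => .one

theorem Label.swap_swap (a : Label) : a.swap.swap = a := by cases a <;> rfl

theorem mulCoeff_swap_swap (a b c : Label) : mulCoeff a.swap b.swap c = mulCoeff a b c := by
  cases a <;> cases b <;> cases c <;> rfl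

/-- Exchanging labels is multiplication by `X`; red and green are its eigenvectors for the
eigenvalues `1` and `-1`. -/
theorem colorCoeff_swap (r : Bool) (a : Label) :
    colorCoeff r a.swap = colorCoeff r a * if r then 1 else -1 := by
  cases a <;> cases r <;> norm_num [colorCoeff, Label.swap]

theorem barSign_orientedState_swap (x : Dart K) (a : Label) :
    barSign K (orientedState K) x a.swap = barSign K (orientedState K) x a *
      if agrees K (mark K (orientedState K) (cyc K (orientedState K) x)) = agrees K x
        then 1 else -1 := by
  simp only [barSign, transport_mark_true_iff]
  by_cases h : agrees K (mark K (orientedState K) (cyc K (orientedState K) x)) = agrees K x <;>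
    cases a <;> simp [h, Label.swap]

/-- The bar operations carry the color from the marked point to `x`, so the choice of marked point
cancels and the local color depends only on `agrees K x` and `o`. -/
theorem color_mul_barSign_factor (o : Bool) (x : Dart K) :
    ((if color K o (.inl (cyc K (orientedState K) x)) then 1 else -1 : ℚ) *
      if agrees K (mark K (orientedState K) (cyc K (orientedState K) x)) = agrees K x
        then 1 else -1) = if agrees K x == o then 1 else -1 := by
  simp only [color]
  rcases Bool.eq_false_or_eq_true
      (agrees K (mark K (orientedState K) (cyc K (orientedState K) x))) with h | h <;>
    rcases Bool.eq_false_or_eq_true (agrees K x) with h' | h' <;> cases o <;> simp [h, h']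

theorem agrees_first (c : Fin K.n) : agrees K (first K c) = true := by
  simp [agrees, first]

theorem agrees_second (c : Fin K.n) : agrees K (second K c) = false := by
  simp [agrees, second]

open Classical in
/-- Swapping the labels of the two cycles at `c`. -/
noncomputable def swapAt (s : State K) (c : Fin K.n) (l : StateCycle K s → Label) :
    StateCycle K s → Label := fun γ =>
  if γ = .inl (cyc K s (first K c)) ∨ γ = .inl (cyc K s (second K c)) then (l γ).swap else l γ

theorem swapAt_involutive (s : State K) (c : Fin K.n) :
    Function.Involutive (swapAt s c) := by
  intro l
  funext γ
  by_cases h : γ = .inl (cyc K s (first K c)) ∨ γ = .inl (cyc K s (second K c)) <;>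
    simp [swapAt, h, Label.swap_swap]

theorem agreeAway_swapAt (s : State K) (c : Fin K.n) (l : StateCycle K s → Label)
    (l' : StateCycle K (resmooth K s c) → Label) :
    AgreeAway K s c (swapAt s c l) l' ↔ AgreeAway K s c l l' := by
  have hfree : ∀ i : Fin K.free, swapAt s c l (.inr i) = l (.inr i) := fun i => by simp [swapAt]
  have haway : ∀ x : Dart K, cyc K s x ≠ cyc K s (first K c) →
      cyc K s x ≠ cyc K s (second K c) →
      swapAt s c l (.inl (cyc K s x)) = l (.inl (cyc K s x)) := fun x h₁ h₂ => by
    simp [swapAt, h₁, h₂]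
  simp only [AgreeAway, hfree]
  refine and_congr_right fun _ => forall_congr' fun x => forall_congr' fun h₁ =>
    forall_congr' fun h₂ => ?_
  rw [haway x h₁ h₂]

open Classical in
theorem prod_colorCoeff_swapAt (o : Bool) (c : Fin K.n)
    (hne : cyc K (orientedState K) (first K c) ≠ cyc K (orientedState K) (second K c))
    (l : StateCycle K (orientedState K) → Label) :
    ∏ γ, colorCoeff (color K o γ) (swapAt (orientedState K) c l γ) =
      (∏ γ, colorCoeff (color K o γ) (l γ)) *
        ((if color K o (.inl (cyc K (orientedState K) (first K c))) then 1 else -1) *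
          if color K o (.inl (cyc K (orientedState K) (second K c))) then 1 else -1) := by
  set γ₁ : StateCycle K (orientedState K) := .inl (cyc K (orientedState K) (first K c)) with h₁
  set γ₂ : StateCycle K (orientedState K) := .inl (cyc K (orientedState K) (second K c)) with h₂
  have h₁₂ : γ₁ ≠ γ₂ := fun h => hne (Sum.inl_injective h)
  have hfactor : ∀ γ, colorCoeff (color K o γ) (swapAt (orientedState K) c l γ) =
      colorCoeff (color K o γ) (l γ) *
        ((if γ = γ₁ then (if color K o γ₁ then 1 else -1) else 1) *
          if γ = γ₂ then (if color K o γ₂ then 1 else -1) else 1) := by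
    intro γ
    simp only [swapAt, ← h₁, ← h₂]
    by_cases hγ₁ : γ = γ₁
    · subst hγ₁
      rw [if_pos (Or.inl rfl), if_pos rfl, if_neg h₁₂, mul_one, colorCoeff_swap]
    · by_cases hγ₂ : γ = γ₂
      · subst hγ₂
        rw [if_pos (Or.inr rfl), if_neg hγ₁, if_pos rfl, one_mul, colorCoeff_swap]
      · rw [if_neg (by tauto), if_neg hγ₁, if_neg hγ₂, mul_one, mul_one]
  rw [Finset.prod_congr rfl fun γ _ => hfactor γ, Finset.prod_mul_distrib,
    Finset.prod_mul_distrib, Finset.prod_ite_eq', Finset.prod_ite_eq',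
    if_pos (Finset.mem_univ _), if_pos (Finset.mem_univ _)]

open Classical in
-- This is `r * g = 0` in coordinates, shown by a sign-reversing involution. Multiplying both
-- merging factors by `X` leaves their product unchanged as `X ^ 2 = 1`, but multiplies red times
-- green by `-1`.
theorem sum_colorCoeff_mul_coeff (hK : ∀ c : Fin K.n, K.positive c = true) (o : Bool)
    (c : Fin K.n) (l' : StateCycle K (resmooth K (orientedState K) c) → Label) :
    ∑ l : StateCycle K (orientedState K) → Label,
      (∏ γ, colorCoeff (color K o γ) (l γ)) * coeff K (orientedState K) c l l' = 0 := by
  have hs' := cyc_resmooth_orientedState_first_eq_second hK c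
  by_cases hne : cyc K (orientedState K) (first K c) = cyc K (orientedState K) (second K c)
  · exact Finset.sum_eq_zero fun l _ => by simp [coeff, hne, hs']
  have hneg : ∀ l : StateCycle K (orientedState K) → Label,
      (∏ γ, colorCoeff (color K o γ) (swapAt (orientedState K) c l γ)) *
        coeff K (orientedState K) c (swapAt (orientedState K) c l) l' =
      -((∏ γ, colorCoeff (color K o γ) (l γ)) * coeff K (orientedState K) c l l') := by
    intro l
    have h₁ : swapAt (orientedState K) c l (.inl (cyc K (orientedState K) (first K c))) =
        (l (.inl (cyc K (orientedState K) (first K c)))).swap := if_pos (Or.inl rfl)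
    have h₂ : swapAt (orientedState K) c l (.inl (cyc K (orientedState K) (second K c))) =
        (l (.inl (cyc K (orientedState K) (second K c)))).swap := if_pos (Or.inr rfl)
    have hsign₁ := color_mul_barSign_factor o (first K c)
    have hsign₂ := color_mul_barSign_factor o (second K c)
    rw [agrees_first] at hsign₁
    rw [agrees_second] at hsign₂
    -- The two arcs at `c` have opposite values of `agrees`, so for either `o` exactly one is
    -- locally red.
    have hsign : ((if (true == o) = true then 1 else -1 : ℚ) *
        if (false == o) = true then 1 else -1) = -1 := by cases o <;> simp
    rw [← hsign₁, ← hsign₂] at hsign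
    rw [prod_colorCoeff_swapAt o c hne]
    simp only [coeff, agreeAway_swapAt, h₁, h₂, mulCoeff_swap_swap, barSign_orientedState_swap,
      agrees_first, agrees_second, if_pos (And.intro hne hs')]
    split_ifs at hsign ⊢ <;> first | (exfalso; norm_num at hsign; done) | ring
  have hsum := (Equiv.sum_comp (swapAt_involutive (orientedState K) c).toPerm fun l =>
    (∏ γ, colorCoeff (color K o γ) (l γ)) * coeff K (orientedState K) c l l').symm
  simp only [Function.Involutive.coe_toPerm, hneg, Finset.sum_neg_distrib] at hsum
  linarith

open Classical in
theorem boundary_orientedState (hK : ∀ c : Fin K.n, K.positive c = true)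
    (l : StateCycle K (orientedState K) → Label) :
    boundary K ⟨orientedState K, l⟩ =
      ∑ c, ∑ l' : StateCycle K (resmooth K (orientedState K) c) → Label,
        Finsupp.single (⟨resmooth K (orientedState K) c, l'⟩ : Enhanced K)
          (coeff K (orientedState K) c l l') :=
  Finset.sum_congr rfl fun c _ => if_pos (by simp [orientedState, hK])

theorem d_canonicalGenerator (hK : ∀ c : Fin K.n, K.positive c = true) (o : Bool) :
    d K (canonicalGenerator K o) = 0 := by
  simp only [canonicalGenerator, map_sum, d, Finsupp.linearCombination_single,
    boundary_orientedState hK, Finset.smul_sum, Finsupp.smul_single, smul_eq_mul]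
  rw [Finset.sum_comm]
  refine Finset.sum_eq_zero fun c _ => ?_
  rw [Finset.sum_comm]
  refine Finset.sum_eq_zero fun l' _ => ?_
  rw [← Finsupp.single_finsetSum, sum_colorCoeff_mul_coeff hK, Finsupp.single_zero]

/-! ### The quantum filtration -/

theorem lam_ge (e : Enhanced K) : -(Nat.card (StateCycle K e.1) : ℤ) ≤ lam K e := by
  have h : ∑ _γ : StateCycle K e.1, (-1 : ℤ) ≤ lam K e :=
    Finset.sum_le_sum fun γ _ => by split_ifs <;> norm_num
  simpa [Nat.card_eq_fintype_card] using h

theorem nPos_eq (hK : ∀ c : Fin K.n, K.positive c = true) : nPos K = K.n := by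
  simp [nPos, hK]

theorem nNeg_eq (hK : ∀ c : Fin K.n, K.positive c = true) : nNeg K = 0 := by
  simp [nNeg, hK]

theorem orientedState_eq (hK : ∀ c : Fin K.n, K.positive c = true) :
    orientedState K = fun _ => false := by
  funext c
  simp [orientedState, hK]

theorem q_orientedX (hK : ∀ c : Fin K.n, K.positive c = true) :
    q K (orientedX K) = -(Nat.card (StateCycle K (orientedState K)) : ℤ) + (K.n : ℤ) := by
  have hB : numB K (orientedX K).1 = 0 := by simp [numB, orientedX, orientedState_eq hK]
  have hlam : lam K (orientedX K) = -(Nat.card (StateCycle K (orientedState K)) : ℤ) := by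
    simp [lam, orientedX, Nat.card_eq_fintype_card]
    rfl
  rw [q, hB, hlam, nPos_eq hK, nNeg_eq hK]
  ring

/-- Each `B`-smoothing adds one to `numB` and at most one cycle, which lowers `lam` by at most one.
-/
theorem q_orientedX_le (hK : ∀ c : Fin K.n, K.positive c = true) (e : Enhanced K) :
    q K (orientedX K) ≤ q K e := by
  have hcard := card_stateCycle_le e.1
  have hlam := lam_ge e
  rw [q_orientedX hK, orientedState_eq hK, q, nPos_eq hK, nNeg_eq hK, numB]
  omega

theorem filtration_eq_top (hK : ∀ c : Fin K.n, K.positive c = true) {j : ℤ}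
    (hj : j ≤ q K (orientedX K)) : filtration K j = ⊤ := by
  rw [filtration, Set.eq_univ_of_forall (s := {e | j ≤ q K e}) fun e =>
    hj.trans (q_orientedX_le hK e), Finsupp.supported_univ]

theorem homologyFiltration_eq_top (hK : ∀ c : Fin K.n, K.positive c = true) {j : ℤ}
    (hj : j ≤ q K (orientedX K)) : homologyFiltration K j = ⊤ := by
  have htop : (⊤ : Submodule ℚ (Chain K)).submoduleOf (LinearMap.ker (d K)) = ⊤ :=
    Submodule.comap_top _
  rw [homologyFiltration, filtration_eq_top hK hj, htop, Submodule.map_top, Submodule.range_mkQ]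

theorem apply_eq_zero_of_mem_filtration {x : Chain K} {e : Enhanced K}
    (hx : x ∈ filtration K (q K e + 1)) : x e = 0 := by
  by_contra h
  have : q K e + 1 ≤ q K e := (Finsupp.mem_supported _ _).mp hx (Finsupp.mem_support_iff.mpr h)
  omega

/-- The coefficient is a product of factors `1 / 2` and `-1 / 2`, since both colors involve `X`. -/
theorem canonicalGenerator_apply_orientedX_ne_zero (o : Bool) :
    canonicalGenerator K o (orientedX K) ≠ 0 := by
  classical
  rw [canonicalGenerator, Finsupp.finsetSum_apply, Finset.sum_eq_single fun _ => Label.X]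
  · rw [orientedX, Finsupp.single_eq_same, Finset.prod_ne_zero_iff]
    intro γ _
    simp only [colorCoeff]
    split_ifs <;> norm_num
  · intro l _ hl
    refine Finsupp.single_eq_of_ne fun h => hl ?_
    exact (eq_of_heq (Sigma.mk.inj h).2).symm
  · exact fun h => absurd (Finset.mem_univ _) h

/-- The differential has no component in a state without `B`-smoothings. -/
theorem d_apply_of_forall_false (x : Chain K) {e : Enhanced K} (he : ∀ c, e.1 c = false) :
    d K x e = 0 := by
  classical
  have hb : ∀ e', boundary K e' e = 0 := by
    intro e'
    rw [boundary, Finsupp.finsetSum_apply]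
    refine Finset.sum_eq_zero fun c _ => ?_
    split_ifs
    · rw [Finsupp.finsetSum_apply]
      refine Finset.sum_eq_zero fun l' _ => Finsupp.single_eq_of_ne fun h => ?_
      have hc := he c
      rw [h] at hc
      simp [resmooth] at hc
    · rfl
  rw [d, Finsupp.linearCombination_apply, Finsupp.sum, Finsupp.finsetSum_apply]
  exact Finset.sum_eq_zero fun e' _ => by rw [Finsupp.smul_apply, hb, smul_zero]

theorem homologyLevel_canonicalGenerator (hK : ∀ c : Fin K.n, K.positive c = true) (o : Bool)
    (h : canonicalGenerator K o ∈ LinearMap.ker (d K)) :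
    HomologyLevel K (homologyClass K ⟨canonicalGenerator K o, h⟩) (q K (orientedX K)) := by
  constructor
  · rw [homologyFiltration_eq_top hK le_rfl]
    exact Submodule.mem_top
  · rintro ⟨z, hz, hzeq⟩
    obtain ⟨w, hw⟩ : (z : Chain K) - canonicalGenerator K o ∈ LinearMap.range (d K) :=
      (Submodule.Quotient.eq ((LinearMap.range (d K)).submoduleOf (LinearMap.ker (d K)))).mp hzeq
    have hzero : (z : Chain K) (orientedX K) = 0 := apply_eq_zero_of_mem_filtration hz
    have hdw : d K w (orientedX K) = 0 :=
      d_apply_of_forall_false w fun c => by simp [orientedX, orientedState, hK]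
    rw [hw, Finsupp.sub_apply, hzero, zero_sub, neg_eq_zero] at hdw
    exact canonicalGenerator_apply_orientedX_ne_zero o hdw

theorem isLeast_filtrationLevels (hK : ∀ c : Fin K.n, K.positive c = true) :
    IsLeast (filtrationLevels K) (q K (orientedX K)) := by
  refine ⟨⟨_, homologyLevel_canonicalGenerator hK true (d_canonicalGenerator hK true)⟩, ?_⟩
  rintro j ⟨y, -, hy⟩
  by_contra hj
  -- For `j` below the minimum, step `j + 1` is still all of the homology, so no class can have
  -- level `j`.
  rw [homologyFiltration_eq_top hK (by omega)] at hy
  exact hy Submodule.mem_top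

end VirtualKhovanov

theorem mainTheorem8 (K : VirtualLinkDiagram) (hK : ∀ c : Fin K.n, K.positive c = true) :
    -- the lowest filtration level exists and equals the quantum grading of the oriented state
    -- with all cycles decorated by X, which is - r + n
    IsLeast (filtrationLevels K) (sMin K) ∧
    sMin K = q K (orientedX K) ∧
    q K (orientedX K) = - (Nat.card (StateCycle K (orientedState K)) : ℤ) + (K.n : ℤ) ∧
    -- this is also the filtration degree of either canonical generator and of its class
    ∀ o : Bool, ChainLevel K (canonicalGenerator K o) (sMin K) ∧
      ∃ h : canonicalGenerator K o ∈ LinearMap.ker (d K),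
        HomologyLevel K (homologyClass K ⟨canonicalGenerator K o, h⟩) (sMin K) := by
  have hleast := isLeast_filtrationLevels hK
  -- Having a least element makes the `sInf` in `sMin` a true minimum and not a default value.
  have hmin : sMin K = q K (orientedX K) := hleast.csInf_eq
  rw [hmin]
  refine ⟨hleast, rfl, q_orientedX hK, fun o => ⟨⟨?_, fun h => ?_⟩, d_canonicalGenerator hK o,
    homologyLevel_canonicalGenerator hK o _⟩⟩
  · rw [filtration_eq_top hK le_rfl]
    exact Submodule.mem_top
  · exact canonicalGenerator_apply_orientedX_ne_zero o (apply_eq_zero_of_mem_filtration h)
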